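/- Fix $p\in(0,1)$, $\bar Y$ and $C_0$. For each $n$ let $A=A^{(n)}$ (the true network) and $G=G^{(n)}$ (the surrogate network) be symmetric binary $n\times n$ matrices with $A_{ii}=1$ for all $i$; let $\mathcal N_i=\{j:A_{ij}=1\}$, $\mathcal M_i=\{j:G_{ij}=1\}$, $d_G=\max_i|\mathcal M_i|$ and $I_{ij}=\mathbf 1\{\mathcal M_i\cap\mathcal M_j\neq\emptyset\}$. Let $Y_i:\{0,1\}^n\to\mathbb R$ ($i\le n$) be potential outcomes such that $Y_i(z)$ depends only on $(z_j)_{j\in\mathcal N_i}$, let $W=(w_{ij})$ be a nonnegative $n\times n$ matrix, and let $\delta=\delta_n\in[0,1]$. Write $\psi_i^k(z)=Y_i(z_{-k},z_k=1)-Y_i(z_{-k},z_k=0)$ and, for $k\ne l$, $\phi_i^{kl}(z)=\psi_i^k(z_{-l},z_l=0)-\psi_i^k(z_{-l},z_l=1)$. Assume, for all $n$ and all $z\in\{0,1\}^n$: 1. $|Y_i(z)|\le\bar Y$ for all $i$. 2. $w_{ij}=0$ if $j\notin\mathcal N_i$; all column sums and all row sums of $W$ are at most $C_0$; $|\psi_i^k(z)|\le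 C_0w_{ik}$ for all $i,k$; and $|\phi_i^{kl}(z)|\le C_0w_{ik}w_{il}$ for all $i$ and all $k\ne l$. 3. $\sum_jw_{ij}A_{ij}(1-G_{ij})\le\delta_n\sum_jw_{ij}$ for all $i$. 4. $\liminf_{n\to\infty}n\sigma_G^2/d_G^2>0$, with $\sigma_G^2$ as defined below. 5. $|\phi_i^{kl}(z_{-j},z_j=1)-\phi_i^{kl}(z_{-j},z_j=0)|\le C_0w_{ik}w_{il}w_{ij}$ for all $i$ and all pairwise distinct $k,l,j$. Let $z_1,\dots,z_n$ be independent Bernoulli($p$), and define $$T_i=\sum_{j\in\mathcal M_i}Y_i(z)\Big(\frac{z_j}{p}-\frac{1-z_j}{1-p}\Big),\qquad \hat\tau=\frac1n\sum_{i=1}^nT_i,\qquad \sigma_G^2=\operatorname{Var}(\hat\tau),$$ $$\hat\sigma_G^2=\frac1{n^2}\sum_{i=1}^n\sum_{j=1}^n(T_i-\hat\tau)(T_j-\hat\tau)I_{ij},\qquad \mathcal R_G=\frac1{nd_G^2}\sum_{i=1}^n\sum_{j=1}^n[E(T_i)-E(\hat\tau)][E(T_j)-E(\hat\tau)]I_{ij}.$$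 Suppose that $d_G^6=o(n)$. Then $E(T_i)=\sum_{k\in\mathcal M_i}E(\psi_i^k(z))$ for all $n$ and $i\le n$, and $$\frac n{d_G^2}\big(\hat\sigma_G^2-\sigma_G^2\big)-\mathcal R_G-b_n\longrightarrow0\quad\text{in probability as }n\to\infty$$ for some deterministic sequence $b_n=O(\delta_n)$; more precisely, $|b_n|\le C\delta_n$ for all $n$ with a constant $C$ that depends only on $p$, $\bar Y$ and $C_0$. -/

import Mathlib

open Filter Topology MeasureTheory ProbabilityTheory Asymptotics

namespace NetInterf

noncomputable section

/-- A treatment assignment of `n` units: `z i = true` if and only if unit `i` is treated. -/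
abbrev Assignment (n : ℕ) : Type := Fin n → Bool

/-- The potential outcomes of `n` units: `Y i z` is the outcome of unit `i` under `z`. -/
abbrev Outcomes (n : ℕ) : Type := Fin n → Assignment n → ℝ

/-- An undirected network on `n` units, as a binary symmetric matrix. The diagonal is free. -/
structure Network (n : ℕ) where
  /-- the binary matrix -/
  mat : Matrix (Fin n) (Fin n) Bool
  symm : mat.IsSymm

namespace Network

variable {n : ℕ}

/-- The entry `(i, j)` as a real number, `0` or `1`. -/
def entry (G : Network n) (i j : Fin n) : ℝ := if G.mat i j = true then 1 else 0

/-- The neighbourhood of unit `i`, which contains `i` itself if the diagonal entry is `1`. -/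
def nbrs (G : Network n) (i : Fin n) : Finset (Fin n) :=
  Finset.univ.filter fun j => G.mat i j = true

/-- The largest size of a neighbourhood. -/
def maxDeg (G : Network n) : ℕ := Finset.univ.sup fun i => (G.nbrs i).card

/-- The indicator that the neighbourhoods of `i` and `j` overlap. -/
def overlap (G : Network n) (i j : Fin n) : ℝ :=
  if (G.nbrs i ∩ G.nbrs j).Nonempty then 1 else 0

end Network

variable {n : ℕ}

/-- The change of `f` when `z k` is switched from control to treatment, the other treatments
being those of `z`. The value does not depend on `z k`. -/
def psi (f : Assignment n → ℝ) (k : Fin n) (z : Assignment n) : ℝ :=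
  f (Function.update z k true) - f (Function.update z k false)

/-- The change of `psi f k` when `z l` is switched from treatment to control. -/
def phi (f : Assignment n → ℝ) (k l : Fin n) (z : Assignment n) : ℝ :=
  psi f k (Function.update z l false) - psi f k (Function.update z l true)

/-- Outcomes are bounded by `Ybar`. -/
def Bounded (Y : Outcomes n) (Ybar : ℝ) : Prop := ∀ i z, |Y i z| ≤ Ybar

/-- Outcomes depend only on the treatments in the true neighbourhood; the weights `W` are
nonnegative, vanish outside of the true neighbourhoods, have column sums (induced `1`-norm) and row
sums (induced `∞`-norm) at most `C₀`, and control the first and second differences of the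
outcomes. -/
structure SmoothOutcomes (A : Network n) (Y : Outcomes n) (W : Matrix (Fin n) (Fin n) ℝ)
    (C₀ : ℝ) : Prop where
  dependsOn : ∀ i, DependsOn (Y i) (A.nbrs i : Set (Fin n))
  nonneg : ∀ i j, 0 ≤ W i j
  support : ∀ i j, j ∉ A.nbrs i → W i j = 0
  col_sum : ∀ j, ∑ i, W i j ≤ C₀
  row_sum : ∀ i, ∑ j, W i j ≤ C₀
  first : ∀ i k z, |psi (Y i) k z| ≤ C₀ * W i k
  second : ∀ i k l, k ≠ l → ∀ z, |phi (Y i) k l z| ≤ C₀ * W i k * W i l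

/-- The weight of the true edges that are missing from the surrogate network is at most a fraction
`δ` of the whole weight, for every unit. -/
def Gap (A G : Network n) (W : Matrix (Fin n) (Fin n) ℝ) (δ : ℝ) : Prop :=
  ∀ i, ∑ j, W i j * A.entry i j * (1 - G.entry i j) ≤ δ * ∑ j, W i j

/-- The weights control the third differences of the outcomes. -/
def SmoothThird (Y : Outcomes n) (W : Matrix (Fin n) (Fin n) ℝ) (C₀ : ℝ) : Prop :=
  ∀ i k l j, k ≠ l → l ≠ j → j ≠ k → ∀ z,
    |phi (Y i) k l (Function.update z j true) - phi (Y i) k l (Function.update z j false)|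
      ≤ C₀ * W i k * W i l * W i j

/-- The uniform Bernoulli design: units are treated independently with probability `p`. -/
def design (n : ℕ) (p : unitInterval) : Measure (Assignment n) :=
  Measure.pi fun _ => bernoulliMeasure true false p

/-- The treatment indicator as a real number. -/
def treat (z : Assignment n) (j : Fin n) : ℝ := if z j = true then 1 else 0

/-- The inverse-probability weight `z_j / p - (1 - z_j) / (1 - p)`. -/
def ipw (p : unitInterval) (z : Assignment n) (j : Fin n) : ℝ :=
  treat z j / (p : ℝ) - (1 - treat z j) / (1 - (p : ℝ))

/-- The summand `T_i` of the estimator. -/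
def T (p : unitInterval) (G : Network n) (Y : Outcomes n) (i : Fin n) (z : Assignment n) : ℝ :=
  ∑ j ∈ G.nbrs i, Y i z * ipw p z j

/-- The pseudo inverse estimator of the total treatment effect. -/
def tauHat (p : unitInterval) (G : Network n) (Y : Outcomes n) (z : Assignment n) : ℝ :=
  (1 / (n : ℝ)) * ∑ i, Y i z * ∑ j ∈ G.nbrs i, ipw p z j

/-- The variance of the estimator under the design. -/
def sigmaSq (p : unitInterval) (G : Network n) (Y : Outcomes n) : ℝ :=
  variance (tauHat p G Y) (design n p)

/-- The neighbourhood-overlap variance estimator. -/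
def sigmaHatSq (p : unitInterval) (G : Network n) (Y : Outcomes n) (z : Assignment n) : ℝ :=
  (1 / (n : ℝ) ^ 2) * ∑ i, ∑ j,
    (T p G Y i z - tauHat p G Y z) * (T p G Y j z - tauHat p G Y z) * G.overlap i j

/-- The expectation of `T_i`. -/
def meanT (p : unitInterval) (G : Network n) (Y : Outcomes n) (i : Fin n) : ℝ :=
  ∫ z, T p G Y i z ∂(design n p)

/-- The expectation of the estimator. -/
def meanTau (p : unitInterval) (G : Network n) (Y : Outcomes n) : ℝ :=
  ∫ z, tauHat p G Y z ∂(design n p)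

/-- The heterogeneity term. -/
def hetero (p : unitInterval) (G : Network n) (Y : Outcomes n) : ℝ :=
  (1 / ((n : ℝ) * (G.maxDeg : ℝ) ^ 2)) * ∑ i, ∑ j,
    (meanT p G Y i - meanTau p G Y) * (meanT p G Y j - meanTau p G Y) * G.overlap i j

/-- Non-degeneracy of a sequence of experiments: `liminf n σ² / d² > 0`. -/
def NonDegenerate (p : unitInterval) (G : ∀ n, Network n) (Y : ∀ n, Outcomes n) : Prop :=
  0 < liminf (fun n : ℕ =>
    (((n : ℝ) * sigmaSq p (G n) (Y n) / ((G n).maxDeg : ℝ) ^ 2 : ℝ) : EReal)) atTop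

end

end NetInterf

/-!
The only probabilistic tool is the covariance form of the Efron–Stein inequality,
`abs_covariance_le`: if switching the treatment of unit `k` moves `f` by at most `a k` and `g` by at
most `b k`, then `|cov(f, g)| ≤ ∑ k, a k * b k`.

Let `d` be the maximal degree of the surrogate network. By `error_eq`, the error in the theorem is
the sum of two terms once `b` is taken to be `bias`, that is, minus `1 / (n d²)` times the sum of
the covariances of `T_i` and `T_j` over the pairs whose neighbourhoods do not overlap.
* The first is `1 / (n d²)` times the centred quadratic form `∑ (T_i - τ) (T_j - τ) I_ij`. One
  treatment moves this form by `O(d⁴)`, since it moves all `T_i` together by `O(d)` and each unit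
  overlaps with at most `d²` others. So the scaled form has variance `O(d⁴ / n)`
  (`Regular.variance_quad_le`).
* The second, `centering`, comes from centring at the estimator `τ` instead of at its mean. It
  consists of covariances with `τ`, each `O(d² / n)` (`Regular.abs_centering_le`).

Hence the second moment of the error is `O(d⁴ / n)`, and Markov's inequality gives the convergence.

It remains to bound `bias` by a multiple of `δ` (`Regular.abs_bias_le`). Integration by parts in the
inverse-probability weights (`integral_mul_ipw`) turns `cov(T_i, T_j)` into a sum over `k ∈ M_i` and
`l ∈ M_j` of `E[Δ_l Δ_k (Y_i Y_j)] - E[Δ_k Y_i] E[Δ_l Y_j]`. Up to terms of size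
`w_il w_jk + w_ik w_il + w_jk w_jl`, the second difference of the product is `Δ_k Y_i Δ_l Y_j`
(`abs_psi_psi_mul_sub_le`), and the covariance of these two factors is at most a multiple of
`w_ik w_jl ∑ m, w_im w_jm`. As `M_i` and `M_j` are disjoint, `l ∉ M_i`, `k ∉ M_j`, and `m` is not in
both, so each of these products has a factor that is the weight of a missing edge. The gap
hypothesis makes the sum over all `i`, `j`, `k`, `l` at most a multiple of `δ n d`.
-/

namespace NetInterf

open Function

variable {n : ℕ}

/-! ### Covariances under the Bernoulli design -/

instance (n : ℕ) (p : unitInterval) : IsProbabilityMeasure (design n p) := by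
  unfold design; infer_instance

/-- The average of `f` over the treatment of unit `k`, the other treatments being fixed. -/
noncomputable def avg (p : unitInterval) (k : Fin n) (f : Assignment n → ℝ) (z : Assignment n) :
    ℝ :=
  p * f (update z k true) + (1 - p) * f (update z k false)

/-- The product probability of the assignment `z`. -/
noncomputable def weight (p : unitInterval) (z : Assignment n) : ℝ :=
  ∏ j, if z j = true then (p : ℝ) else 1 - p

lemma integral_design (p : unitInterval) (f : Assignment n → ℝ) :
    ∫ z, f z ∂design n p = ∑ z, weight p z * f z := by
  rw [integral_fintype Integrable.of_finite]
  refine Finset.sum_congr rfl fun z _ => ?_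
  rw [smul_eq_mul, measureReal_def, design, Measure.pi_singleton, ENNReal.toReal_prod, weight]
  congr 1
  refine Finset.prod_congr rfl fun j _ => ?_
  rw [← measureReal_def]
  cases z j <;> simp

lemma weight_update (p : unitInterval) (z : Assignment n) (k : Fin n) (b : Bool) :
    weight p (update z k b) =
      (if b = true then (p : ℝ) else 1 - p) *
        ∏ j ∈ Finset.univ.erase k, if z j = true then (p : ℝ) else 1 - p := by
  rw [weight, ← Finset.mul_prod_erase _ _ (Finset.mem_univ k)]
  congr 1
  · simp
  · refine Finset.prod_congr rfl fun j hj => ?_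
    rw [update_of_ne (Finset.ne_of_mem_erase hj)]

lemma psi_update (f : Assignment n → ℝ) (k : Fin n) (z : Assignment n) (b : Bool) :
    psi f k (update z k b) = psi f k z := by
  simp [psi]

lemma psi_psi_self (f : Assignment n → ℝ) (k : Fin n) (z : Assignment n) :
    psi (psi f k) k z = 0 := by
  simp [psi]

lemma psi_avg_self (p : unitInterval) (f : Assignment n → ℝ) (k : Fin n) (z : Assignment n) :
    psi (avg p k f) k z = 0 := by
  simp [psi, avg]

lemma psi_avg_of_ne (p : unitInterval) (f : Assignment n → ℝ) {k l : Fin n} (h : k ≠ l)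
    (z : Assignment n) : psi (avg p l f) k z = avg p l (psi f k) z := by
  simp only [psi, avg, update_comm h]
  ring

lemma apply_eq_avg_add (p : unitInterval) (f : Assignment n → ℝ) (k : Fin n) (z : Assignment n) :
    f z = avg p k f z + (treat z k - p) * psi f k z := by
  have h : update z k (z k) = z := update_eq_self k z
  cases hz : z k <;> rw [hz] at h <;> simp [avg, psi, treat, hz, h] <;> ring

/-- A function which does not depend on the treatment of unit `k` is orthogonal to the centred
treatment of `k`: the two values of that treatment cancel. -/
lemma integral_treat_sub_mul (p : unitInterval) (k : Fin n) (h : Assignment n → ℝ)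
    (hh : ∀ z b, h (update z k b) = h z) :
    ∫ z, (treat z k - p) * h z ∂design n p = 0 := by
  rw [integral_design]
  have key : ∀ z : Assignment n, weight p (update z k (!z k)) *
      ((treat (update z k (!z k)) k - p) * h (update z k (!z k))) =
        -(weight p z * ((treat z k - p) * h z)) := by
    intro z
    have hw : weight p z = weight p (update z k (z k)) := by rw [update_eq_self]
    rw [hw, weight_update, weight_update, hh]
    cases hz : z k <;> simp [treat, hz] <;> ring
  have h2 := Equiv.sum_comp (show Assignment n ≃ Assignment n from
    { toFun := fun z => update z k (!z k)
      invFun := fun z => update z k (!z k)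
      left_inv := fun z => by simp
      right_inv := fun z => by simp })
    (fun z => weight p z * ((treat z k - p) * h z))
  simp only [Equiv.coe_fn_mk, key, Finset.sum_neg_distrib] at h2
  linarith

lemma integral_avg (p : unitInterval) (k : Fin n) (f : Assignment n → ℝ) :
    ∫ z, avg p k f z ∂design n p = ∫ z, f z ∂design n p := by
  conv_rhs => enter [2, z]; rw [apply_eq_avg_add p f k z]
  rw [integral_add Integrable.of_finite Integrable.of_finite,
    integral_treat_sub_mul p k _ fun z b => psi_update f k z b, add_zero]

/-- Inverse-probability weighting identifies the effect of the treatment of unit `k`. -/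
lemma integral_mul_ipw (p : unitInterval) (hp0 : 0 < (p : ℝ)) (hp1 : (p : ℝ) < 1)
    (f : Assignment n → ℝ) (k : Fin n) :
    ∫ z, f z * ipw p z k ∂design n p = ∫ z, psi f k z ∂design n p := by
  rw [← integral_avg p k]
  congr 1 with z
  have : (1 : ℝ) - p ≠ 0 := by linarith
  simp [avg, psi, ipw, treat]
  field_simp
  ring

/-- Averaging over one treatment preserves uniform bounds on the differences. -/
lemma abs_psi_avg_le (p : unitInterval) {f : Assignment n → ℝ} {k : Fin n} {a : ℝ}
    (h : ∀ z, |psi f k z| ≤ a) (l : Fin n) (z : Assignment n) : |psi (avg p l f) k z| ≤ a := by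
  have ha : 0 ≤ a := (abs_nonneg _).trans (h z)
  by_cases hkl : k = l
  · subst hkl
    simpa [psi_avg_self] using ha
  · rw [psi_avg_of_ne p f hkl, avg]
    have h1 := abs_le.1 (h (update z l true))
    have h2 := abs_le.1 (h (update z l false))
    have hp := p.2.1
    have hp' := p.2.2
    rw [abs_le]
    constructor <;> nlinarith

/-- The successive averages of `f` over the treatments of the units in the list `L`. -/
noncomputable def avgList (p : unitInterval) (L : List (Fin n)) (f : Assignment n → ℝ) :
    Assignment n → ℝ :=
  L.foldr (avg p) f

lemma avgList_cons (p : unitInterval) (k : Fin n) (L : List (Fin n)) (f : Assignment n → ℝ) :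
    avgList p (k :: L) f = avg p k (avgList p L f) := rfl

lemma integral_avgList (p : unitInterval) (L : List (Fin n)) (f : Assignment n → ℝ) :
    ∫ z, avgList p L f z ∂design n p = ∫ z, f z ∂design n p := by
  induction L with
  | nil => rfl
  | cons k L ih => rw [avgList_cons, integral_avg, ih]

lemma abs_psi_avgList_le (p : unitInterval) {f : Assignment n → ℝ} {k : Fin n} {a : ℝ}
    (h : ∀ z, |psi f k z| ≤ a) (L : List (Fin n)) (z : Assignment n) :
    |psi (avgList p L f) k z| ≤ a := by
  induction L generalizing z with
  | nil => exact h z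
  | cons l L ih => exact abs_psi_avg_le p ih l z

lemma psi_avgList_of_mem (p : unitInterval) (f : Assignment n → ℝ) {k : Fin n}
    {L : List (Fin n)} (hk : k ∈ L) (z : Assignment n) : psi (avgList p L f) k z = 0 := by
  induction L generalizing z with
  | nil => simp at hk
  | cons l L ih =>
    rw [avgList_cons]
    by_cases hkl : k = l
    · subst hkl
      exact psi_avg_self p _ k z
    · have := ih (List.mem_of_ne_of_mem hkl hk)
      simpa using abs_psi_avg_le p (a := 0) (fun z => by simp [this z]) l z

lemma eq_of_psi_eq_zero {f : Assignment n → ℝ} (h : ∀ k z, psi f k z = 0)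
    (z z' : Assignment n) : f z = f z' := by
  have hup : ∀ k b (y : Assignment n), f (update y k b) = f y := by
    intro k b y
    have h1 := h k y
    have h2 : update y k (y k) = y := update_eq_self k y
    unfold psi at h1
    cases hy : y k <;> rw [hy] at h2 <;> cases b <;> first | rw [h2] | (rw [h2] at h1; linarith)
  have key : ∀ S : Finset (Fin n), f (S.piecewise z z') = f z' := by
    intro S
    induction S using Finset.induction_on with
    | empty => simp
    | insert a S _ ih => rw [Finset.piecewise_insert, hup, ih]
  simpa using key Finset.univ

/-- Averaging over all treatments leaves no dependence, so that it gives the expectation. -/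
lemma avgList_univ (p : unitInterval) (f : Assignment n → ℝ) (z : Assignment n) :
    avgList p Finset.univ.toList f z = ∫ y, f y ∂design n p := by
  rw [← integral_avgList p Finset.univ.toList f]
  have : avgList p Finset.univ.toList f = fun _ => avgList p Finset.univ.toList f z := by
    ext y
    exact eq_of_psi_eq_zero (fun k z => psi_avgList_of_mem p f (by simp) z) y z
  rw [this]
  simp

/-- The covariance inequality for the coordinates in a list, conditionally on the others. -/
lemma abs_avgList_mul_sub_le (p : unitInterval) {f g : Assignment n → ℝ} {a b : Fin n → ℝ}
    (hf : ∀ k z, |psi f k z| ≤ a k) (hg : ∀ k z, |psi g k z| ≤ b k) (L : List (Fin n))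
    (z : Assignment n) :
    |avgList p L (fun z => f z * g z) z - avgList p L f z * avgList p L g z| ≤
      (L.map fun k => a k * b k).sum := by
  induction L generalizing z with
  | nil => simp [avgList]
  | cons k L ih =>
    set F := avgList p L f
    set H := avgList p L g
    -- The covariance over one more coordinate is an average of the previous ones plus the
    -- covariance of two functions of that coordinate.
    have hsplit : avgList p (k :: L) (fun z => f z * g z) z -
        avgList p (k :: L) f z * avgList p (k :: L) g z =
        p * (avgList p L (fun z => f z * g z) (update z k true) -
          F (update z k true) * H (update z k true)) +
        (1 - p) * (avgList p L (fun z => f z * g z) (update z k false) -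
          F (update z k false) * H (update z k false)) +
        p * (1 - p) * (psi F k z * psi H k z) := by
      simp only [avgList_cons, avg, psi, F, H]
      ring
    have hprod : |psi F k z * psi H k z| ≤ a k * b k := by
      rw [abs_mul]
      exact mul_le_mul (abs_psi_avgList_le p (hf k) L z) (abs_psi_avgList_le p (hg k) L z)
        (abs_nonneg _) ((abs_nonneg _).trans (hf k z))
    have h1 := abs_le.1 (ih (update z k true))
    have h2 := abs_le.1 (ih (update z k false))
    have h3 := abs_le.1 hprod
    have hp := p.2.1
    have hp' : 0 ≤ 1 - (p : ℝ) := by linarith [p.2.2]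
    have hab : 0 ≤ a k * b k := (abs_nonneg _).trans hprod
    have hpp : (p : ℝ) * (1 - p) ≤ 1 := by nlinarith
    have hpp' : 0 ≤ (p : ℝ) * (1 - p) := mul_nonneg hp hp'
    have h4 : |p * (1 - p) * (psi F k z * psi H k z)| ≤ a k * b k := by
      rw [abs_mul, abs_of_nonneg hpp']
      exact (mul_le_of_le_one_left (abs_nonneg _) hpp).trans hprod
    have h5 := abs_le.1 h4
    rw [hsplit, List.map_cons, List.sum_cons, abs_le]
    constructor <;> nlinarith

lemma memLp_design (p : unitInterval) (f : Assignment n → ℝ) : MemLp f 2 (design n p) :=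
  MemLp.of_discrete

lemma covariance_design (p : unitInterval) (f g : Assignment n → ℝ) :
    cov[f, g; design n p] = ∫ z, f z * g z ∂design n p -
      (∫ z, f z ∂design n p) * ∫ z, g z ∂design n p :=
  covariance_eq_sub (memLp_design p f) (memLp_design p g)

/-- The covariance form of the Efron–Stein inequality, with uniform bounds on the differences. -/
lemma abs_covariance_le (p : unitInterval) {f g : Assignment n → ℝ} {a b : Fin n → ℝ}
    (hf : ∀ k z, |psi f k z| ≤ a k) (hg : ∀ k z, |psi g k z| ≤ b k) :
    |cov[f, g; design n p]| ≤ ∑ k, a k * b k := by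
  have h := abs_avgList_mul_sub_le p hf hg Finset.univ.toList (fun _ => true)
  rw [avgList_univ, avgList_univ, avgList_univ, Finset.sum_map_toList] at h
  rwa [covariance_design]

/-! ### Neighbourhoods and weights -/

namespace Network

variable (G : Network n)

lemma mem_nbrs {i j : Fin n} : j ∈ G.nbrs i ↔ G.mat i j = true := by
  simp [nbrs]

lemma entry_comm (i j : Fin n) : G.entry i j = G.entry j i := by
  rw [entry, entry, G.symm.apply]

lemma entry_nonneg (i j : Fin n) : 0 ≤ G.entry i j := by
  rw [entry]; split_ifs <;> norm_num

lemma card_nbrs_le (i : Fin n) : ((G.nbrs i).card : ℝ) ≤ G.maxDeg := by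
  exact_mod_cast Finset.le_sup (f := fun i => (G.nbrs i).card) (Finset.mem_univ i)

lemma sum_nbrs (i : Fin n) (f : Fin n → ℝ) : ∑ j ∈ G.nbrs i, f j = ∑ j, f j * G.entry i j := by
  simp [nbrs, Finset.sum_filter, entry]

lemma sum_entry_right_le (i : Fin n) : ∑ j, G.entry i j ≤ G.maxDeg := by
  simpa using (G.sum_nbrs i fun _ => 1).symm.trans_le (by simpa using G.card_nbrs_le i)

lemma sum_entry_left_le (j : Fin n) : ∑ i, G.entry i j ≤ G.maxDeg := by
  simpa only [G.entry_comm _ j] using G.sum_entry_right_le j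

lemma overlap_comm (i j : Fin n) : G.overlap i j = G.overlap j i := by
  rw [overlap, overlap, Finset.inter_comm]

lemma overlap_nonneg (i j : Fin n) : 0 ≤ G.overlap i j := by
  rw [overlap]; split_ifs <;> norm_num

lemma overlap_le (i j : Fin n) : G.overlap i j ≤ ∑ k, G.entry i k * G.entry j k := by
  have h0 : ∀ k ∈ Finset.univ, 0 ≤ G.entry i k * G.entry j k :=
    fun k _ => mul_nonneg (G.entry_nonneg i k) (G.entry_nonneg j k)
  rw [overlap]
  split_ifs with h
  · obtain ⟨k, hk⟩ := h
    rw [Finset.mem_inter, mem_nbrs, mem_nbrs] at hk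
    refine le_trans ?_ (Finset.single_le_sum h0 (Finset.mem_univ k))
    simp [entry, hk.1, hk.2]
  · exact Finset.sum_nonneg h0

/-- Each unit overlaps with at most the neighbours of its neighbours. -/
lemma sum_overlap_le (i : Fin n) : ∑ j, G.overlap i j ≤ (G.maxDeg : ℝ) ^ 2 := by
  calc ∑ j, G.overlap i j ≤ ∑ j, ∑ k, G.entry i k * G.entry j k :=
        Finset.sum_le_sum fun j _ => G.overlap_le i j
    _ = ∑ k, G.entry i k * ∑ j, G.entry j k := by
        rw [Finset.sum_comm]; simp_rw [Finset.mul_sum]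
    _ ≤ ∑ k, G.entry i k * G.maxDeg :=
        Finset.sum_le_sum fun k _ =>
          mul_le_mul_of_nonneg_left (G.sum_entry_left_le k) (G.entry_nonneg i k)
    _ = (∑ k, G.entry i k) * G.maxDeg := by rw [Finset.sum_mul]
    _ ≤ (G.maxDeg : ℝ) ^ 2 := by
        rw [sq]; exact mul_le_mul_of_nonneg_right (G.sum_entry_right_le i) (by positivity)

lemma notMem_of_overlap_eq_zero {i j k : Fin n} (h : G.overlap i j = 0) (hi : k ∈ G.nbrs i) :
    k ∉ G.nbrs j := by
  intro hj
  rw [overlap, if_pos ⟨k, Finset.mem_inter.2 ⟨hi, hj⟩⟩] at h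
  exact one_ne_zero h

/-- The weight that `i` puts on `l` if `l` is outside of the neighbourhood of `i`, and `0`
otherwise. -/
noncomputable def missing (W : Matrix (Fin n) (Fin n) ℝ) (i l : Fin n) : ℝ :=
  W i l * (1 - G.entry i l)

lemma missing_of_notMem (W : Matrix (Fin n) (Fin n) ℝ) {i l : Fin n} (h : l ∉ G.nbrs i) :
    G.missing W i l = W i l := by
  rw [mem_nbrs] at h
  simp [missing, entry, h]

end Network

/-- The hypotheses on the outcomes and on the weights of one experiment, and the bounds on the
inverse-probability weights, with a common constant `B`. -/
structure Regular (p : unitInterval) (G : Network n) (Y : Outcomes n)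
    (W : Matrix (Fin n) (Fin n) ℝ) (δ B : ℝ) : Prop where
  one_le : 1 ≤ B
  bounded : ∀ i z, |Y i z| ≤ B
  nonneg : ∀ i j, 0 ≤ W i j
  col_sum : ∀ j, ∑ i, W i j ≤ B
  row_sum : ∀ i, ∑ j, W i j ≤ B
  first : ∀ i k z, |psi (Y i) k z| ≤ B * W i k
  second : ∀ i k l, k ≠ l → ∀ z, |phi (Y i) k l z| ≤ B * W i k * W i l
  missing : ∀ i, ∑ l, G.missing W i l ≤ δ * B
  ipw_le : ∀ (z : Assignment n) k, |ipw p z k| ≤ B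
  ipw_diff : |1 / (p : ℝ) + 1 / (1 - p)| ≤ B

/-! ### Sensitivity of the estimator to a single treatment -/

lemma psi_mul (f g : Assignment n → ℝ) (k : Fin n) (z : Assignment n) :
    psi (fun z => f z * g z) k z =
      psi f k z * g (update z k true) + f (update z k false) * psi g k z := by
  simp only [psi]; ring

lemma psi_sum {ι : Type*} (s : Finset ι) (f : ι → Assignment n → ℝ) (k : Fin n)
    (z : Assignment n) : psi (fun z => ∑ i ∈ s, f i z) k z = ∑ i ∈ s, psi (f i) k z := by
  simp only [psi, Finset.sum_sub_distrib]

lemma psi_ipw (p : unitInterval) (j k : Fin n) (z : Assignment n) :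
    psi (fun z => ipw p z j) k z = if j = k then 1 / (p : ℝ) + 1 / (1 - p) else 0 := by
  split_ifs with h
  · subst h; simp [psi, ipw, treat]
  · simp [psi, ipw, treat, update_of_ne h]

lemma T_eq (p : unitInterval) (G : Network n) (Y : Outcomes n) (i : Fin n) :
    T p G Y i = fun z => Y i z * ∑ j ∈ G.nbrs i, ipw p z j := by
  ext z; rw [T, Finset.mul_sum]

lemma tauHat_eq (p : unitInterval) (G : Network n) (Y : Outcomes n) :
    tauHat p G Y = fun z => (1 / (n : ℝ)) * ∑ i, T p G Y i z := by
  ext z; simp only [tauHat, T_eq]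

lemma psi_tauHat (p : unitInterval) (G : Network n) (Y : Outcomes n) (k : Fin n)
    (z : Assignment n) :
    psi (tauHat p G Y) k z = (1 / (n : ℝ)) * ∑ i, psi (T p G Y i) k z := by
  rw [tauHat_eq, ← psi_sum]; simp only [psi]; ring

/-- The expectation of `T_i` is the total of the expected unit effects over the neighbourhood. -/
lemma meanT_eq (p : unitInterval) (hp0 : 0 < (p : ℝ)) (hp1 : (p : ℝ) < 1) (G : Network n)
    (Y : Outcomes n) (i : Fin n) :
    meanT p G Y i = ∑ k ∈ G.nbrs i, ∫ z, psi (Y i) k z ∂design n p := by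
  simp only [meanT, T]
  rw [integral_finsetSum _ fun _ _ => Integrable.of_finite]
  exact Finset.sum_congr rfl fun k _ => integral_mul_ipw p hp0 hp1 _ k

/-- The residual of unit `i` about the estimator. -/
noncomputable def resid (p : unitInterval) (G : Network n) (Y : Outcomes n) (i : Fin n)
    (z : Assignment n) : ℝ :=
  T p G Y i z - tauHat p G Y z

/-- The quadratic form in the residuals from which the variance estimator is built. -/
noncomputable def quad (p : unitInterval) (G : Network n) (Y : Outcomes n) (z : Assignment n) : ℝ :=
  ∑ i, ∑ j, resid p G Y i z * resid p G Y j z * G.overlap i j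

/-- A bound for the effect of the treatment of unit `k` on `T_i`. -/
noncomputable def diffBound (G : Network n) (W : Matrix (Fin n) (Fin n) ℝ) (B : ℝ)
    (i k : Fin n) : ℝ :=
  B ^ 2 * (G.maxDeg * W i k + G.entry i k)

namespace Regular

variable {p : unitInterval} {G : Network n} {Y : Outcomes n} {W : Matrix (Fin n) (Fin n) ℝ}
  {δ B : ℝ} (h : Regular p G Y W δ B)

include h

lemma pos : 0 < B := by linarith [h.one_le]

lemma abs_sum_ipw_le (i : Fin n) (z : Assignment n) :
    |∑ j ∈ G.nbrs i, ipw p z j| ≤ B * G.maxDeg := by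
  refine (Finset.abs_sum_le_sum_abs _ _).trans ?_
  refine (Finset.sum_le_sum fun j _ => h.ipw_le z j).trans ?_
  rw [Finset.sum_const, nsmul_eq_mul, mul_comm]
  exact mul_le_mul_of_nonneg_left (G.card_nbrs_le i) h.pos.le

lemma abs_T_le (i : Fin n) (z : Assignment n) : |T p G Y i z| ≤ B ^ 2 * G.maxDeg := by
  rw [T_eq, abs_mul, sq, mul_assoc]
  exact mul_le_mul (h.bounded i z) (h.abs_sum_ipw_le i z) (abs_nonneg _) h.pos.le

lemma abs_tauHat_le (z : Assignment n) : |tauHat p G Y z| ≤ B ^ 2 * G.maxDeg := by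
  have h0 : 0 ≤ B ^ 2 * G.maxDeg := by positivity
  rw [tauHat_eq, abs_mul, abs_of_nonneg (by positivity), one_div_mul_eq_div]
  refine div_le_of_le_mul₀ (by positivity) h0 ?_
  refine (Finset.abs_sum_le_sum_abs _ _).trans ?_
  refine (Finset.sum_le_sum fun j _ => h.abs_T_le j z).trans ?_
  simp [mul_comm]

lemma abs_resid_le (i : Fin n) (z : Assignment n) :
    |resid p G Y i z| ≤ 2 * B ^ 2 * G.maxDeg := by
  have := abs_sub (T p G Y i z) (tauHat p G Y z)
  rw [resid]
  linarith [h.abs_T_le i z, h.abs_tauHat_le z]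

lemma abs_psi_T_le (i k : Fin n) (z : Assignment n) :
    |psi (T p G Y i) k z| ≤ diffBound G W B i k := by
  have hS : psi (fun z => ∑ j ∈ G.nbrs i, ipw p z j) k z =
      (1 / (p : ℝ) + 1 / (1 - p)) * G.entry i k := by
    rw [psi_sum, G.sum_nbrs]
    simp [psi_ipw]
  rw [T_eq, psi_mul, hS, diffBound]
  refine (abs_add_le _ _).trans ?_
  have h1 := mul_le_mul (h.first i k z) (h.abs_sum_ipw_le i (update z k true)) (abs_nonneg _)
    (mul_nonneg h.pos.le (h.nonneg i k))
  have h2 := mul_le_mul (h.bounded i (update z k false))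
    (mul_le_mul_of_nonneg_right h.ipw_diff (G.entry_nonneg i k))
    (mul_nonneg (abs_nonneg _) (G.entry_nonneg i k)) h.pos.le
  rw [abs_mul, abs_mul, abs_mul, abs_of_nonneg (G.entry_nonneg i k)]
  linarith

lemma diffBound_nonneg (i k : Fin n) : 0 ≤ diffBound G W B i k :=
  mul_nonneg (sq_nonneg _) (add_nonneg (mul_nonneg (by positivity) (h.nonneg i k))
    (G.entry_nonneg i k))

lemma sum_diffBound_aux {w e : Fin n → ℝ} (hw : ∑ i, w i ≤ B) (he : ∑ i, e i ≤ G.maxDeg) :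
    ∑ i, B ^ 2 * (G.maxDeg * w i + e i) ≤ 2 * B ^ 3 * G.maxDeg := by
  rw [← Finset.mul_sum, Finset.sum_add_distrib, ← Finset.mul_sum]
  have hd : (0 : ℝ) ≤ G.maxDeg := by positivity
  have h1 : (G.maxDeg : ℝ) * ∑ i, w i + ∑ i, e i ≤ G.maxDeg * B + G.maxDeg * B := by
    have := mul_le_mul_of_nonneg_left hw hd
    have := mul_le_mul_of_nonneg_left h.one_le hd
    linarith
  have := mul_le_mul_of_nonneg_left h1 (sq_nonneg B)
  linarith

lemma sum_diffBound_left_le (k : Fin n) :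
    ∑ i, diffBound G W B i k ≤ 2 * B ^ 3 * G.maxDeg :=
  h.sum_diffBound_aux (h.col_sum k) (G.sum_entry_left_le k)

lemma sum_diffBound_right_le (i : Fin n) :
    ∑ k, diffBound G W B i k ≤ 2 * B ^ 3 * G.maxDeg :=
  h.sum_diffBound_aux (h.row_sum i) (G.sum_entry_right_le i)

lemma abs_psi_tauHat_le (k : Fin n) (z : Assignment n) :
    |psi (tauHat p G Y) k z| ≤ 2 * B ^ 3 * G.maxDeg / n := by
  rw [psi_tauHat, abs_mul, abs_of_nonneg (by positivity), one_div_mul_eq_div]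
  refine div_le_div_of_nonneg_right ?_ (by positivity)
  refine (Finset.abs_sum_le_sum_abs _ _).trans ?_
  exact (Finset.sum_le_sum fun i _ => h.abs_psi_T_le i k z).trans (h.sum_diffBound_left_le k)

lemma abs_covariance_T_tauHat_le (i : Fin n) :
    |cov[T p G Y i, tauHat p G Y; design n p]| ≤ 4 * B ^ 6 * (G.maxDeg : ℝ) ^ 2 / n := by
  have hB := h.pos
  refine (abs_covariance_le p (h.abs_psi_T_le i) h.abs_psi_tauHat_le).trans ?_
  rw [← Finset.sum_mul]
  refine (mul_le_mul_of_nonneg_right (h.sum_diffBound_right_le i) (by positivity)).trans_eq ?_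
  ring

lemma abs_covariance_tauHat_le :
    |cov[tauHat p G Y, tauHat p G Y; design n p]| ≤ 4 * B ^ 6 * (G.maxDeg : ℝ) ^ 2 / n := by
  refine (abs_covariance_le p h.abs_psi_tauHat_le h.abs_psi_tauHat_le).trans_eq ?_
  rw [Finset.sum_const, Finset.card_univ, Fintype.card_fin, nsmul_eq_mul]
  rcases eq_or_ne (n : ℝ) 0 with hn | hn
  · simp [hn]
  · field_simp
    ring

lemma abs_psi_resid_le (i k : Fin n) (z : Assignment n) :
    |psi (resid p G Y i) k z| ≤ diffBound G W B i k + 2 * B ^ 3 * G.maxDeg / n := by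
  have : psi (resid p G Y i) k z = psi (T p G Y i) k z - psi (tauHat p G Y) k z := by
    simp only [psi, resid]; ring
  rw [this]
  exact (abs_sub _ _).trans (add_le_add (h.abs_psi_T_le i k z) (h.abs_psi_tauHat_le k z))

/-- Each residual is of order `d`, and the effects of the treatment of `k` on all residuals add up
to order `d`; every residual occurs in at most `d ^ 2` products. -/
lemma abs_psi_quad_le (k : Fin n) (z : Assignment n) :
    |psi (quad p G Y) k z| ≤ 16 * B ^ 5 * (G.maxDeg : ℝ) ^ 4 := by
  have hB := h.pos
  set u : Fin n → ℝ := fun i => diffBound G W B i k + 2 * B ^ 3 * G.maxDeg / n with hu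
  have hu0 : ∀ i, 0 ≤ u i := fun i => add_nonneg (h.diffBound_nonneg i k) (by positivity)
  have hsum : ∑ i, u i ≤ 4 * B ^ 3 * G.maxDeg := by
    have h1 : (n : ℝ) * (2 * B ^ 3 * G.maxDeg / n) ≤ 2 * B ^ 3 * G.maxDeg := by
      rcases eq_or_ne (n : ℝ) 0 with hn | hn
      · rw [hn, zero_mul]; positivity
      · rw [mul_div_cancel₀ _ hn]
    rw [hu, Finset.sum_add_distrib, Finset.sum_const, Finset.card_univ, Fintype.card_fin,
      nsmul_eq_mul]
    linarith [h.sum_diffBound_left_le k]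
  have hpair : ∀ i j, |psi (fun z => resid p G Y i z * resid p G Y j z * G.overlap i j) k z| ≤
      2 * B ^ 2 * G.maxDeg * (u i * G.overlap i j + u j * G.overlap j i) := by
    intro i j
    have h1 : psi (fun z => resid p G Y i z * resid p G Y j z * G.overlap i j) k z =
        (psi (resid p G Y i) k z * resid p G Y j (update z k true) +
          resid p G Y i (update z k false) * psi (resid p G Y j) k z) * G.overlap i j := by
      simp only [psi]; ring
    rw [h1, abs_mul, abs_of_nonneg (G.overlap_nonneg i j), G.overlap_comm j i, ← add_mul,
      ← mul_assoc]
    refine mul_le_mul_of_nonneg_right ?_ (G.overlap_nonneg i j)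
    refine (abs_add_le _ _).trans ?_
    rw [abs_mul, abs_mul]
    have h2 := mul_le_mul (h.abs_psi_resid_le i k z) (h.abs_resid_le j (update z k true))
      (abs_nonneg _) (hu0 i)
    have h3 := mul_le_mul (h.abs_resid_le i (update z k false)) (h.abs_psi_resid_le j k z)
      (abs_nonneg _) (by positivity)
    simp only [hu]
    linarith
  have hrow : ∑ i, ∑ j, u i * G.overlap i j ≤ 4 * B ^ 3 * G.maxDeg * (G.maxDeg : ℝ) ^ 2 := by
    simp_rw [← Finset.mul_sum]
    refine (Finset.sum_le_sum fun i _ =>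
      mul_le_mul_of_nonneg_left (G.sum_overlap_le i) (hu0 i)).trans ?_
    rw [← Finset.sum_mul]
    exact mul_le_mul_of_nonneg_right hsum (by positivity)
  have hcol : ∑ i, ∑ j, u j * G.overlap j i = ∑ i, ∑ j, u i * G.overlap i j := Finset.sum_comm
  have hq : quad p G Y = fun z => ∑ i, ∑ j,
      resid p G Y i z * resid p G Y j z * G.overlap i j := rfl
  rw [hq, psi_sum]
  simp_rw [psi_sum]
  calc _ ≤ ∑ i, ∑ j, 2 * B ^ 2 * G.maxDeg * (u i * G.overlap i j + u j * G.overlap j i) :=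
        (Finset.abs_sum_le_sum_abs _ _).trans <| Finset.sum_le_sum fun i _ =>
          (Finset.abs_sum_le_sum_abs _ _).trans <| Finset.sum_le_sum fun j _ => hpair i j
    _ = 2 * B ^ 2 * G.maxDeg * (2 * ∑ i, ∑ j, u i * G.overlap i j) := by
        rw [two_mul (∑ i, ∑ j, u i * G.overlap i j)]
        nth_rw 2 [← hcol]
        simp_rw [← Finset.sum_add_distrib, Finset.mul_sum]
    _ ≤ 2 * B ^ 2 * G.maxDeg * (2 * (4 * B ^ 3 * G.maxDeg * (G.maxDeg : ℝ) ^ 2)) := by gcongr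
    _ = 16 * B ^ 5 * (G.maxDeg : ℝ) ^ 4 := by ring

lemma variance_quad_le :
    variance (quad p G Y) (design n p) ≤ n * (256 * B ^ 10 * (G.maxDeg : ℝ) ^ 8) := by
  rw [← covariance_self (memLp_design p _).aestronglyMeasurable.aemeasurable]
  refine (le_abs_self _).trans ((abs_covariance_le p h.abs_psi_quad_le h.abs_psi_quad_le).trans ?_)
  rw [Finset.sum_const, Finset.card_univ, Fintype.card_fin, nsmul_eq_mul]
  refine le_of_eq ?_
  ring

end Regular

/-! ### Covariances of units with disjoint neighbourhoods -/

/-- The second difference of a product is the product of the first differences in separate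
coordinates, up to terms in which one factor is a second difference, or in which the two
coordinates are exchanged. -/
lemma abs_psi_psi_mul_sub_le {f g : Assignment n → ℝ} {k l : Fin n} (hkl : k ≠ l)
    {B βf αg γf γg : ℝ} (hf : ∀ z, |f z| ≤ B) (hg : ∀ z, |g z| ≤ B)
    (hfl : ∀ z, |psi f l z| ≤ βf) (hgk : ∀ z, |psi g k z| ≤ αg)
    (hff : ∀ z, |phi f k l z| ≤ γf) (hgg : ∀ z, |phi g k l z| ≤ γg) (z : Assignment n) :
    |psi (psi (fun z => f z * g z) k) l z - psi f k z * psi g l z| ≤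
      βf * αg + γf * B + γg * (3 * B) := by
  have hbound : ∀ x y u v b f₁ f₂ f₃ : ℝ, |x| ≤ βf → |y| ≤ αg → |u| ≤ γf → |v| ≤ γg → |b| ≤ B →
      |f₁| ≤ B → |f₂| ≤ B → |f₃| ≤ B →
      |x * y + u * b + v * (f₁ + f₂ - f₃)| ≤ βf * αg + γf * B + γg * (3 * B) := by
    intro x y u v b f₁ f₂ f₃ hx hy hu hv hb h₁ h₂ h₃
    have h4 : |f₁ + f₂ - f₃| ≤ 3 * B := by
      have := abs_sub (f₁ + f₂) f₃
      have := abs_add_le f₁ f₂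
      linarith
    refine (abs_add_le _ _).trans (add_le_add ((abs_add_le _ _).trans (add_le_add ?_ ?_)) ?_) <;>
      rw [abs_mul]
    · exact mul_le_mul hx hy (abs_nonneg _) ((abs_nonneg _).trans hx)
    · exact mul_le_mul hu hb (abs_nonneg _) ((abs_nonneg _).trans hu)
    · exact mul_le_mul hv h4 (abs_nonneg _) ((abs_nonneg _).trans hv)
  -- `F a b` and `H a b` are the values at the corners of the square spanned by `k` and `l`; the
  -- expansion is about the corner at which `z` lies.
  set F : Bool → Bool → ℝ := fun a b => f (update (update z k a) l b) with hF
  set H : Bool → Bool → ℝ := fun a b => g (update (update z k a) l b) with hH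
  have hz : update (update z k (z k)) l (z l) = z := by simp
  have e1 : psi (psi (fun z => f z * g z) k) l z = F true true * H true true -
      F false true * H false true - (F true false * H true false - F false false * H false false) :=
    by simp only [psi, hF, hH, update_comm hkl]
  have e2 : psi f k z = F true (z l) - F false (z l) := by
    simp only [psi, hF, update_comm hkl]
    simp only [update_eq_self]
  have e3 : psi g l z = H (z k) true - H (z k) false := by
    simp only [psi, hH, update_eq_self]
  have e4 : ∀ a, |F a true - F a false| ≤ βf := fun a => by
    simpa [psi, hF] using hfl (update z k a)
  have e5 : ∀ b, |H true b - H false b| ≤ αg := fun b => by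
    simpa [psi, hH, update_comm hkl] using hgk (update z l b)
  have e6 : |F true true - F true false - F false true + F false false| ≤ γf := by
    rw [← abs_neg]
    convert hff z using 2
    simp only [phi, psi, hF, update_comm hkl]
    ring
  have e7 : |H true true - H true false - H false true + H false false| ≤ γg := by
    rw [← abs_neg]
    convert hgg z using 2
    simp only [phi, psi, hH, update_comm hkl]
    ring
  have hFB : ∀ a b, |F a b| ≤ B := fun a b => hf _
  have hHB : ∀ a b, |H a b| ≤ B := fun a b => hg _
  rw [e1, e2, e3]
  clear_value F H
  cases z k <;> cases z l
  · convert hbound (F false true - F false false) (H true false - H false false) _ _ (H true true)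
      (F false true) (F true false) (F false false) (e4 _) (e5 _) e6 e7 (hHB _ _) (hFB _ _)
      (hFB _ _) (hFB _ _) using 2
    ring
  · convert hbound (F false true - F false false) (H true true - H false true) _ _ (H true false)
      (F true true) (F false false) (F false true) (e4 _) (e5 _) e6 e7 (hHB _ _) (hFB _ _)
      (hFB _ _) (hFB _ _) using 2
    ring
  · convert hbound (F true true - F true false) (H true false - H false false) _ _ (H false true)
      (F true true) (F false false) (F true false) (e4 _) (e5 _) e6 e7 (hHB _ _) (hFB _ _)
      (hFB _ _) (hFB _ _) using 2
    ring
  · convert hbound (F true true - F true false) (H true true - H false true) _ _ (H false false)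
      (F true false) (F false true) (F true true) (e4 _) (e5 _) e6 e7 (hHB _ _) (hFB _ _)
      (hFB _ _) (hFB _ _) using 2
    ring

/-- For non-overlapping neighbourhoods, the covariance of the summands in terms of the differences
of the outcomes. -/
lemma covariance_T_of_overlap_eq_zero (p : unitInterval) (hp0 : 0 < (p : ℝ)) (hp1 : (p : ℝ) < 1)
    {G : Network n} (Y : Outcomes n) {i j : Fin n} (hij : G.overlap i j = 0) :
    cov[T p G Y i, T p G Y j; design n p] = ∑ k ∈ G.nbrs i, ∑ l ∈ G.nbrs j,
      (∫ z, psi (psi (fun z => Y i z * Y j z) k) l z ∂design n p -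
        (∫ z, psi (Y i) k z ∂design n p) * ∫ z, psi (Y j) l z ∂design n p) := by
  have hprod : ∀ z, T p G Y i z * T p G Y j z =
      ∑ k ∈ G.nbrs i, ∑ l ∈ G.nbrs j, Y i z * Y j z * ipw p z l * ipw p z k := by
    intro z
    rw [T, T, Finset.sum_mul_sum]
    exact Finset.sum_congr rfl fun k _ => Finset.sum_congr rfl fun l _ => by ring
  have hmean : ∀ i, ∫ z, T p G Y i z ∂design n p = ∑ k ∈ G.nbrs i, ∫ z, psi (Y i) k z ∂design n p :=
    meanT_eq p hp0 hp1 G Y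
  rw [covariance_design, hmean, hmean, Finset.sum_mul_sum]
  simp_rw [hprod, Finset.sum_sub_distrib]
  congr 1
  rw [integral_finsetSum _ fun _ _ => Integrable.of_finite]
  refine Finset.sum_congr rfl fun k hk => ?_
  rw [integral_finsetSum _ fun _ _ => Integrable.of_finite]
  refine Finset.sum_congr rfl fun l hl => ?_
  have hlk : l ≠ k := by
    rintro rfl
    exact G.notMem_of_overlap_eq_zero hij hk hl
  rw [integral_mul_ipw p hp0 hp1 (fun z => Y i z * Y j z * ipw p z l) k,
    ← integral_mul_ipw p hp0 hp1 (psi (fun z => Y i z * Y j z) k) l]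
  congr 1 with z
  simp only [psi, ipw, treat, update_of_ne hlk]
  ring

lemma psi_psi_eq_neg_phi (f : Assignment n → ℝ) (k l : Fin n) (z : Assignment n) :
    psi (psi f k) l z = -phi f k l z := by
  simp only [psi, phi]; ring

namespace Network

variable (G : Network n)

/-- The weight that unit `i` puts outside of its own neighbourhood and inside that of `j`. -/
noncomputable def crossing (W : Matrix (Fin n) (Fin n) ℝ) (i j : Fin n) : ℝ :=
  ∑ l, G.missing W i l * G.entry j l

/-- The overlap of the weights that `i` puts outside of its neighbourhood with the weights of
`j`. -/
noncomputable def common (W : Matrix (Fin n) (Fin n) ℝ) (i j : Fin n) : ℝ :=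
  ∑ m, G.missing W i m * W j m

end Network

namespace Regular

variable {p : unitInterval} {G : Network n} {Y : Outcomes n} {W : Matrix (Fin n) (Fin n) ℝ}
  {δ B : ℝ} (h : Regular p G Y W δ B)

include h

lemma missing_nonneg (i l : Fin n) : 0 ≤ G.missing W i l := by
  refine mul_nonneg (h.nonneg i l) ?_
  rw [Network.entry]; split_ifs <;> norm_num

lemma crossing_nonneg (i j : Fin n) : 0 ≤ G.crossing W i j :=
  Finset.sum_nonneg fun l _ => mul_nonneg (h.missing_nonneg i l) (G.entry_nonneg j l)

lemma common_nonneg (i j : Fin n) : 0 ≤ G.common W i j :=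
  Finset.sum_nonneg fun l _ => mul_nonneg (h.missing_nonneg i l) (h.nonneg j l)

lemma sum_nbrs_le (i j : Fin n) : ∑ k ∈ G.nbrs i, W j k ≤ B :=
  (Finset.sum_le_sum_of_subset_of_nonneg (Finset.subset_univ _) fun k _ _ => h.nonneg j k).trans
    (h.row_sum j)

/-- Weights missing from the neighbourhood of `i` have total at most `δ * B`, and this survives
summing against an array with bounded column sums. -/
lemma sum_mul_le (i : Fin n) {c : Fin n → Fin n → ℝ} {D : ℝ} (hD : 0 ≤ D)
    (hc : ∀ l, ∑ j, c j l ≤ D) : ∑ j, ∑ l, G.missing W i l * c j l ≤ δ * B * D := by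
  rw [Finset.sum_comm]
  simp_rw [← Finset.mul_sum]
  refine (Finset.sum_le_sum fun l _ =>
    mul_le_mul_of_nonneg_left (hc l) (h.missing_nonneg i l)).trans ?_
  rw [← Finset.sum_mul]
  exact mul_le_mul_of_nonneg_right (h.missing i) hD

lemma sum_crossing_le (i : Fin n) : ∑ j, G.crossing W i j ≤ δ * B * G.maxDeg :=
  h.sum_mul_le i (by positivity) G.sum_entry_left_le

lemma sum_common_le (i : Fin n) : ∑ j, G.common W i j ≤ δ * B * B :=
  h.sum_mul_le i h.pos.le h.col_sum

/-- Of two non-overlapping neighbourhoods, at most one contains a given unit `m`, so that its weight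
is missing from the other one. -/
lemma sum_mul_le_common (i j : Fin n) (hij : G.overlap i j = 0) :
    ∑ m, W i m * W j m ≤ G.common W i j + G.common W j i := by
  rw [Network.common, Network.common, ← Finset.sum_add_distrib]
  refine Finset.sum_le_sum fun m _ => ?_
  have h1 := mul_nonneg (h.missing_nonneg i m) (h.nonneg j m)
  have h2 := mul_nonneg (h.missing_nonneg j m) (h.nonneg i m)
  by_cases hm : m ∈ G.nbrs i
  · rw [G.missing_of_notMem W (G.notMem_of_overlap_eq_zero hij hm)] at *
    linarith
  · rw [G.missing_of_notMem W hm] at *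
    linarith

/-- The differences of two outcomes are nearly uncorrelated: the effect of the treatment of `m` on
both of them is a product of second differences. -/
lemma abs_covariance_psi_le (i j k l : Fin n) :
    |cov[psi (Y i) k, psi (Y j) l; design n p]| ≤
      B ^ 2 * (W i k * W j l) * ∑ m, W i m * W j m := by
  have hB := h.pos
  have hsecond : ∀ i k m z, |psi (psi (Y i) k) m z| ≤ B * W i k * W i m := by
    intro i k m z
    by_cases hkm : k = m
    · subst hkm
      rw [psi_psi_self, abs_zero]
      exact mul_nonneg (mul_nonneg hB.le (h.nonneg i k)) (h.nonneg i k)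
    · rw [psi_psi_eq_neg_phi, abs_neg]
      exact h.second i k m hkm z
  refine (abs_covariance_le p (hsecond i k) (hsecond j l)).trans_eq ?_
  rw [Finset.mul_sum]
  exact Finset.sum_congr rfl fun m _ => by ring

/-- For non-overlapping neighbourhoods, each term of the covariance contains a weight that is
missing from the surrogate network. -/
lemma abs_covariance_T_le (hp0 : 0 < (p : ℝ)) (hp1 : (p : ℝ) < 1) {i j : Fin n}
    (hij : G.overlap i j = 0) :
    |cov[T p G Y i, T p G Y j; design n p]| ≤
      6 * B ^ 3 * (G.crossing W i j + G.crossing W j i) +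
        B ^ 4 * (G.common W i j + G.common W j i) := by
  have hB := h.pos
  set κ : ℝ := ∑ m, W i m * W j m
  have hκ0 : 0 ≤ κ := Finset.sum_nonneg fun m _ => mul_nonneg (h.nonneg i m) (h.nonneg j m)
  have hpair : ∀ k ∈ G.nbrs i, ∀ l ∈ G.nbrs j,
      |∫ z, psi (psi (fun z => Y i z * Y j z) k) l z ∂design n p -
        (∫ z, psi (Y i) k z ∂design n p) * ∫ z, psi (Y j) l z ∂design n p| ≤
      B ^ 2 * (G.missing W i l * W j k) + B ^ 2 * (W i k * G.missing W i l) +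
        3 * B ^ 2 * (G.missing W j k * W j l) + B ^ 2 * κ * (W i k * W j l) := by
    intro k hk l hl
    have hlj : k ∉ G.nbrs j := G.notMem_of_overlap_eq_zero hij hk
    have hli : l ∉ G.nbrs i := fun hi => G.notMem_of_overlap_eq_zero hij hi hl
    have hkl : k ≠ l := by rintro rfl; exact hlj hl
    rw [G.missing_of_notMem W hli, G.missing_of_notMem W hlj]
    have h1 : |∫ z, (psi (psi (fun z => Y i z * Y j z) k) l z - psi (Y i) k z * psi (Y j) l z)
        ∂design n p| ≤
        (B * W i l) * (B * W j k) + (B * W i k * W i l) * B + (B * W j k * W j l) * (3 * B) := by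
      have := norm_integral_le_of_norm_le_const (μ := design n p) (Eventually.of_forall fun z =>
        (Real.norm_eq_abs _).trans_le (abs_psi_psi_mul_sub_le hkl (h.bounded i) (h.bounded j)
          (h.first i l) (h.first j k) (h.second i k l hkl) (h.second j k l hkl) z))
      simpa using this
    have h2 := h.abs_covariance_psi_le i j k l
    rw [covariance_design] at h2
    rw [integral_sub Integrable.of_finite Integrable.of_finite] at h1
    have h3 := (abs_add_le _ _).trans (add_le_add h1 h2)
    rw [sub_add_sub_cancel] at h3
    refine h3.trans_eq ?_
    ring
  have hW : ∀ i j, 0 ≤ ∑ k ∈ G.nbrs i, W j k := fun i j =>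
    Finset.sum_nonneg fun k _ => h.nonneg j k
  have hcr : ∀ i j, ∑ l ∈ G.nbrs j, G.missing W i l = G.crossing W i j := fun i j =>
    G.sum_nbrs j _
  rw [covariance_T_of_overlap_eq_zero p hp0 hp1 Y hij]
  calc _ ≤ ∑ k ∈ G.nbrs i, ∑ l ∈ G.nbrs j,
        (B ^ 2 * (G.missing W i l * W j k) + B ^ 2 * (W i k * G.missing W i l) +
          3 * B ^ 2 * (G.missing W j k * W j l) + B ^ 2 * κ * (W i k * W j l)) :=
        (Finset.abs_sum_le_sum_abs _ _).trans <| Finset.sum_le_sum fun k hk =>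
          (Finset.abs_sum_le_sum_abs _ _).trans <| Finset.sum_le_sum fun l hl => hpair k hk l hl
    _ = B ^ 2 * ((∑ k ∈ G.nbrs i, W j k) * G.crossing W i j) +
        B ^ 2 * ((∑ k ∈ G.nbrs i, W i k) * G.crossing W i j) +
        3 * B ^ 2 * (G.crossing W j i * ∑ l ∈ G.nbrs j, W j l) +
        B ^ 2 * κ * ((∑ k ∈ G.nbrs i, W i k) * ∑ l ∈ G.nbrs j, W j l) := by
        simp only [Finset.sum_add_distrib, ← Finset.mul_sum, ← Finset.sum_mul, hcr]
        ring
    _ ≤ B ^ 2 * (B * G.crossing W i j) + B ^ 2 * (B * G.crossing W i j) +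
        3 * B ^ 2 * (G.crossing W j i * B) +
        B ^ 2 * (G.common W i j + G.common W j i) * (B * B) := by
        have hκle := h.sum_mul_le_common i j hij
        have c1 := h.crossing_nonneg i j
        have c2 := h.crossing_nonneg j i
        have c3 := add_nonneg (h.common_nonneg i j) (h.common_nonneg j i)
        have s1 := h.sum_nbrs_le i j
        have s2 := h.sum_nbrs_le i i
        have s3 := h.sum_nbrs_le j j
        have s4 := hW i i
        have s5 := hW j j
        gcongr
    _ ≤ _ := by
        have c1 := mul_nonneg (pow_nonneg hB.le 3) (h.crossing_nonneg i j)
        have c2 := mul_nonneg (pow_nonneg hB.le 3) (h.crossing_nonneg j i)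
        linarith

/-- The covariances of the summands with non-overlapping neighbourhoods, which the variance
estimator leaves out, are due to the missing edges alone. -/
lemma sum_covariance_le (hp0 : 0 < (p : ℝ)) (hp1 : (p : ℝ) < 1) (hδ : 0 ≤ δ) :
    |∑ i, ∑ j, (1 - G.overlap i j) * cov[T p G Y i, T p G Y j; design n p]| ≤
      14 * B ^ 6 * δ * (n * (G.maxDeg : ℝ) ^ 2) := by
  have hB := h.pos
  -- Degree zero is separate: the last estimate below uses `1 ≤ d`.
  rcases Nat.eq_zero_or_pos G.maxDeg with hd | hd
  · have hT : ∀ i, T p G Y i = fun _ => 0 := by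
      intro i
      ext z
      simpa [hd] using h.abs_T_le i z
    simp [hT, hd]
  have hd1 : (1 : ℝ) ≤ G.maxDeg := by exact_mod_cast hd
  have hterm : ∀ i j, |(1 - G.overlap i j) * cov[T p G Y i, T p G Y j; design n p]| ≤
      6 * B ^ 3 * (G.crossing W i j + G.crossing W j i) +
        B ^ 4 * (G.common W i j + G.common W j i) := by
    intro i j
    have c1 := h.crossing_nonneg i j
    have c2 := h.crossing_nonneg j i
    have c3 := h.common_nonneg i j
    have c4 := h.common_nonneg j i
    by_cases hij : (G.nbrs i ∩ G.nbrs j).Nonempty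
    · have : G.overlap i j = 1 := if_pos hij
      rw [this, sub_self, zero_mul, abs_zero]
      positivity
    · have : G.overlap i j = 0 := if_neg hij
      rw [this, sub_zero, one_mul]
      exact h.abs_covariance_T_le hp0 hp1 this
  have hP : ∑ i, ∑ j, G.crossing W i j ≤ n * (δ * B * G.maxDeg) := by
    simpa using Finset.sum_le_sum fun i (_ : i ∈ Finset.univ) => h.sum_crossing_le i
  have hR : ∑ i, ∑ j, G.common W i j ≤ n * (δ * B * B) := by
    simpa using Finset.sum_le_sum fun i (_ : i ∈ Finset.univ) => h.sum_common_le i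
  have hP' : ∑ i, ∑ j, G.crossing W j i = ∑ i, ∑ j, G.crossing W i j := Finset.sum_comm
  have hR' : ∑ i, ∑ j, G.common W j i = ∑ i, ∑ j, G.common W i j := Finset.sum_comm
  calc _ ≤ ∑ i, ∑ j, (6 * B ^ 3 * (G.crossing W i j + G.crossing W j i) +
        B ^ 4 * (G.common W i j + G.common W j i)) :=
        (Finset.abs_sum_le_sum_abs _ _).trans <| Finset.sum_le_sum fun i _ =>
          (Finset.abs_sum_le_sum_abs _ _).trans <| Finset.sum_le_sum fun j _ => hterm i j
    _ = 12 * B ^ 3 * ∑ i, ∑ j, G.crossing W i j + 2 * B ^ 4 * ∑ i, ∑ j, G.common W i j := by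
        simp only [Finset.sum_add_distrib, ← Finset.mul_sum, hP', hR']
        ring
    _ ≤ 12 * B ^ 3 * (n * (δ * B * G.maxDeg)) + 2 * B ^ 4 * (n * (δ * B * B)) := by gcongr
    _ = 12 * B ^ 4 * (n * δ) * G.maxDeg + 2 * B ^ 6 * (n * δ) * 1 := by ring
    _ ≤ 12 * B ^ 6 * (n * δ) * (G.maxDeg : ℝ) ^ 2 + 2 * B ^ 6 * (n * δ) * (G.maxDeg : ℝ) ^ 2 := by
        have := h.one_le
        have hdd : (G.maxDeg : ℝ) ≤ (G.maxDeg : ℝ) ^ 2 := le_self_pow₀ hd1 two_ne_zero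
        have hdd' : 1 ≤ (G.maxDeg : ℝ) ^ 2 := one_le_pow₀ hd1
        gcongr
        norm_num
    _ = _ := by ring

end Regular

/-! ### The error of the variance estimator -/

lemma integral_resid (p : unitInterval) (G : Network n) (Y : Outcomes n) (i : Fin n) :
    ∫ z, resid p G Y i z ∂design n p = meanT p G Y i - meanTau p G Y :=
  integral_sub Integrable.of_finite Integrable.of_finite

/-- Expanding the covariances of the residuals shows what the overlap indicator cuts off. -/
lemma integral_quad (p : unitInterval) (G : Network n) (Y : Outcomes n) :
    ∫ z, quad p G Y z ∂design n p = ∑ i, ∑ j,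
      (cov[T p G Y i, T p G Y j; design n p] - cov[T p G Y i, tauHat p G Y; design n p] -
        cov[T p G Y j, tauHat p G Y; design n p] + cov[tauHat p G Y, tauHat p G Y; design n p] +
        (meanT p G Y i - meanTau p G Y) * (meanT p G Y j - meanTau p G Y)) * G.overlap i j := by
  unfold quad
  rw [integral_finsetSum _ fun _ _ => Integrable.of_finite]
  refine Finset.sum_congr rfl fun i _ => ?_
  rw [integral_finsetSum _ fun _ _ => Integrable.of_finite]
  refine Finset.sum_congr rfl fun j _ => ?_
  rw [integral_mul_const]
  congr 1
  have h1 := covariance_design p (resid p G Y i) (resid p G Y j)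
  have h2 : cov[resid p G Y i, resid p G Y j; design n p] = _ :=
    covariance_fun_sub_fun_sub (memLp_design p (T p G Y i)) (memLp_design p (tauHat p G Y))
      (memLp_design p (T p G Y j)) (memLp_design p (tauHat p G Y))
  rw [integral_resid, integral_resid] at h1
  rw [covariance_comm (tauHat p G Y) (T p G Y j)] at h2
  linarith

lemma sigmaSq_eq (p : unitInterval) (G : Network n) (Y : Outcomes n) :
    sigmaSq p G Y =
      (1 / (n : ℝ) ^ 2) * ∑ i, ∑ j, cov[T p G Y i, T p G Y j; design n p] := by
  rw [sigmaSq, ← covariance_self (memLp_design p _).aestronglyMeasurable.aemeasurable, tauHat_eq,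
    covariance_const_mul_left, covariance_const_mul_right,
    covariance_fun_sum_fun_sum (fun i => memLp_design p _) (fun i => memLp_design p _)]
  ring

/-- The limiting bias of the variance estimator: it leaves out the covariances of the summands
whose neighbourhoods do not overlap. -/
noncomputable def bias (p : unitInterval) (G : Network n) (Y : Outcomes n) : ℝ :=
  -(1 / ((n : ℝ) * (G.maxDeg : ℝ) ^ 2) *
    ∑ i, ∑ j, (1 - G.overlap i j) * cov[T p G Y i, T p G Y j; design n p])

/-- The part of the bias of the variance estimator that comes from centring the summands at the
estimator instead of at its mean. -/
noncomputable def centering (p : unitInterval) (G : Network n) (Y : Outcomes n) : ℝ :=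
  1 / ((n : ℝ) * (G.maxDeg : ℝ) ^ 2) * ∑ i, ∑ j,
    (cov[tauHat p G Y, tauHat p G Y; design n p] - cov[T p G Y i, tauHat p G Y; design n p] -
      cov[T p G Y j, tauHat p G Y; design n p]) * G.overlap i j

/-- The error of the variance estimator, less the asymptotic bias and the heterogeneity term, is a
centred quadratic form plus a small deterministic term. It also holds if `n = 0` or the maximal
degree is `0`, where both sides divide by zero. -/
lemma error_eq (p : unitInterval) (G : Network n) (Y : Outcomes n) (z : Assignment n) :
    (n : ℝ) / (G.maxDeg : ℝ) ^ 2 * (sigmaHatSq p G Y z - sigmaSq p G Y) -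
        (bias p G Y + hetero p G Y) =
      1 / ((n : ℝ) * (G.maxDeg : ℝ) ^ 2) * (quad p G Y z - ∫ y, quad p G Y y ∂design n p) +
        centering p G Y := by
  have hs : sigmaHatSq p G Y z = (1 / (n : ℝ) ^ 2) * quad p G Y z := rfl
  have hn : (n : ℝ) / (G.maxDeg : ℝ) ^ 2 * (1 / (n : ℝ) ^ 2) =
      1 / ((n : ℝ) * (G.maxDeg : ℝ) ^ 2) := by
    rcases eq_or_ne (n : ℝ) 0 with hn | hn
    · simp [hn]
    rcases eq_or_ne (G.maxDeg : ℝ) 0 with hd | hd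
    · simp [hd]
    field_simp
  have hsum : ∑ i, ∑ j, cov[T p G Y i, T p G Y j; design n p] -
      ∑ i, ∑ j, (1 - G.overlap i j) * cov[T p G Y i, T p G Y j; design n p] +
      ∑ i, ∑ j, (meanT p G Y i - meanTau p G Y) * (meanT p G Y j - meanTau p G Y) *
        G.overlap i j =
      ∫ y, quad p G Y y ∂design n p - ∑ i, ∑ j,
        (cov[tauHat p G Y, tauHat p G Y; design n p] - cov[T p G Y i, tauHat p G Y; design n p] -
          cov[T p G Y j, tauHat p G Y; design n p]) * G.overlap i j := by
    rw [integral_quad]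
    simp_rw [← Finset.sum_sub_distrib, ← Finset.sum_add_distrib]
    exact Finset.sum_congr rfl fun i _ => Finset.sum_congr rfl fun j _ => by ring
  rw [hs, sigmaSq_eq, ← mul_sub, ← mul_assoc, hn, bias, hetero, centering]
  linear_combination -(1 / ((n : ℝ) * (G.maxDeg : ℝ) ^ 2)) * hsum

namespace Regular

variable {p : unitInterval} {G : Network n} {Y : Outcomes n} {W : Matrix (Fin n) (Fin n) ℝ}
  {δ B : ℝ} (h : Regular p G Y W δ B)

include h

lemma abs_bias_le (hp0 : 0 < (p : ℝ)) (hp1 : (p : ℝ) < 1) (hδ : 0 ≤ δ) :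
    |bias p G Y| ≤ 14 * B ^ 6 * δ := by
  have hB := h.pos
  rw [bias, abs_neg, abs_mul, abs_of_nonneg (by positivity), one_div_mul_eq_div]
  exact div_le_of_le_mul₀ (by positivity) (by positivity) (h.sum_covariance_le hp0 hp1 hδ)

lemma abs_centering_le : |centering p G Y| ≤ 12 * B ^ 6 * (G.maxDeg : ℝ) ^ 2 / n := by
  have hB := h.pos
  have hterm : ∀ i j, |(cov[tauHat p G Y, tauHat p G Y; design n p] -
      cov[T p G Y i, tauHat p G Y; design n p] - cov[T p G Y j, tauHat p G Y; design n p]) *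
        G.overlap i j| ≤ 12 * B ^ 6 * (G.maxDeg : ℝ) ^ 2 / n * G.overlap i j := by
    intro i j
    rw [abs_mul, abs_of_nonneg (G.overlap_nonneg i j)]
    refine mul_le_mul_of_nonneg_right ?_ (G.overlap_nonneg i j)
    refine (abs_sub _ _).trans ((add_le_add_left (abs_sub _ _) _).trans ?_)
    have h1 := h.abs_covariance_tauHat_le
    have h2 := h.abs_covariance_T_tauHat_le i
    have h3 := h.abs_covariance_T_tauHat_le j
    refine (add_le_add (add_le_add h1 h2) h3).trans_eq ?_
    ring
  have hover : ∑ i, ∑ j, G.overlap i j ≤ n * (G.maxDeg : ℝ) ^ 2 := by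
    simpa using Finset.sum_le_sum fun i (_ : i ∈ Finset.univ) => G.sum_overlap_le i
  rw [centering, abs_mul, abs_of_nonneg (by positivity), one_div_mul_eq_div]
  refine div_le_of_le_mul₀ (by positivity) (by positivity) ?_
  calc _ ≤ ∑ i, ∑ j, 12 * B ^ 6 * (G.maxDeg : ℝ) ^ 2 / n * G.overlap i j :=
        (Finset.abs_sum_le_sum_abs _ _).trans <| Finset.sum_le_sum fun i _ =>
          (Finset.abs_sum_le_sum_abs _ _).trans <| Finset.sum_le_sum fun j _ => hterm i j
    _ = 12 * B ^ 6 * (G.maxDeg : ℝ) ^ 2 / n * ∑ i, ∑ j, G.overlap i j := by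
        simp_rw [Finset.mul_sum]
    _ ≤ _ := mul_le_mul_of_nonneg_left hover (by positivity)

/-- The second moment is the variance of the quadratic form plus the square of the centring
bias. -/
lemma integral_error_sq_le :
    ∫ z, ((n : ℝ) / (G.maxDeg : ℝ) ^ 2 * (sigmaHatSq p G Y z - sigmaSq p G Y) -
        (bias p G Y + hetero p G Y)) ^ 2 ∂design n p ≤
      400 * B ^ 12 * ((G.maxDeg : ℝ) ^ 4 / n) := by
  have hB := h.pos
  simp_rw [error_eq]
  set c : ℝ := 1 / ((n : ℝ) * (G.maxDeg : ℝ) ^ 2) with hc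
  set m : ℝ := ∫ y, quad p G Y y ∂design n p with hm
  set r : ℝ := centering p G Y
  have hsq : ∫ z, (c * (quad p G Y z - m) + r) ^ 2 ∂design n p =
      c ^ 2 * variance (quad p G Y) (design n p) + r ^ 2 := by
    have hexp : ∀ z, (c * (quad p G Y z - m) + r) ^ 2 =
        c ^ 2 * (quad p G Y z - m) ^ 2 + (2 * c * r * (quad p G Y z - m) + r ^ 2) := by
      intro z; ring
    have hzero : ∫ z, (quad p G Y z - m) ∂design n p = 0 := by
      rw [integral_sub Integrable.of_finite Integrable.of_finite, ← hm]
      simp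
    simp_rw [hexp]
    rw [integral_add Integrable.of_finite Integrable.of_finite,
      integral_add Integrable.of_finite Integrable.of_finite, integral_const_mul,
      integral_const_mul, hzero,
      variance_eq_integral (memLp_design p _).aestronglyMeasurable.aemeasurable]
    simp [hm]
  rw [hsq]
  rcases Nat.eq_zero_or_pos n with hn | hn
  · have hr := h.abs_centering_le
    have hn' : (n : ℝ) = 0 := by exact_mod_cast hn
    rw [hn', div_zero] at hr
    simp [hc, hn', abs_nonpos_iff.1 hr, r]
  have hn1 : (1 : ℝ) ≤ n := by exact_mod_cast hn
  have h1 : c ^ 2 * variance (quad p G Y) (design n p) ≤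
      256 * B ^ 10 * ((G.maxDeg : ℝ) ^ 4 / n) := by
    refine (mul_le_mul_of_nonneg_left h.variance_quad_le (sq_nonneg c)).trans_eq ?_
    rcases eq_or_ne (G.maxDeg : ℝ) 0 with hd | hd
    · simp [hd]
    rw [hc]
    field_simp
  have h2 : r ^ 2 ≤ 144 * B ^ 12 * ((G.maxDeg : ℝ) ^ 4 / n) := by
    have h3 : r ^ 2 ≤ (12 * B ^ 6 * (G.maxDeg : ℝ) ^ 2 / n) ^ 2 := by
      rw [← sq_abs r]
      exact pow_le_pow_left₀ (abs_nonneg _) h.abs_centering_le 2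
    have h4 : (12 * B ^ 6 * (G.maxDeg : ℝ) ^ 2 / n) ^ 2 =
        144 * B ^ 12 * ((G.maxDeg : ℝ) ^ 4 / n) / n := by ring
    exact (h3.trans_eq h4).trans (div_le_self (by positivity) hn1)
  have h5 : 256 * B ^ 10 * ((G.maxDeg : ℝ) ^ 4 / n) ≤
      256 * B ^ 12 * ((G.maxDeg : ℝ) ^ 4 / n) := by
    have := h.one_le
    gcongr
    norm_num
  linarith

/-- Markov's inequality for the squared error of the variance estimator. -/
lemma measure_error_le {ε : ℝ} (hε : 0 < ε) :
    design n p {z | ε ≤ |(n : ℝ) / (G.maxDeg : ℝ) ^ 2 * (sigmaHatSq p G Y z - sigmaSq p G Y) -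
        (bias p G Y + hetero p G Y)|} ≤
      ENNReal.ofReal (400 * B ^ 12 / ε ^ 2 * ((G.maxDeg : ℝ) ^ 4 / n)) := by
  set X : Assignment n → ℝ := fun z => (n : ℝ) / (G.maxDeg : ℝ) ^ 2 *
    (sigmaHatSq p G Y z - sigmaSq p G Y) - (bias p G Y + hetero p G Y)
  have hset : {z | ε ≤ |X z|} = {z | ε ^ 2 ≤ X z ^ 2} := by
    ext z
    rw [Set.mem_ofPred_eq, Set.mem_ofPred_eq, sq_le_sq, abs_of_pos hε]
  have hM : ε ^ 2 * (design n p).real {z | ε ^ 2 ≤ X z ^ 2} ≤ ∫ z, X z ^ 2 ∂design n p :=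
    mul_meas_ge_le_integral_of_nonneg (Eventually.of_forall fun z => sq_nonneg _)
      Integrable.of_finite _
  have hreal : (design n p).real {z | ε ^ 2 ≤ X z ^ 2} ≤
      400 * B ^ 12 / ε ^ 2 * ((G.maxDeg : ℝ) ^ 4 / n) := by
    rw [div_mul_eq_mul_div, le_div_iff₀' (by positivity)]
    exact hM.trans h.integral_error_sq_le
  change design n p {z | ε ≤ |X z|} ≤ _
  rw [hset, ← ofReal_measureReal]
  exact ENNReal.ofReal_le_ofReal hreal

end Regular

/-! ### Convergence in probability -/

/-- The hypotheses of the experiment give a common constant that depends on `p` and on the bounds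
alone. -/
lemma regular_of_smooth {p : unitInterval} (hp0 : 0 < (p : ℝ)) (hp1 : (p : ℝ) < 1)
    {Ybar C₀ δ : ℝ} {A G : Network n} {Y : Outcomes n} {W : Matrix (Fin n) (Fin n) ℝ}
    (hb : Bounded Y Ybar) (hs : SmoothOutcomes A Y W C₀) (hδ : 0 ≤ δ) (hg : Gap A G W δ) :
    Regular p G Y W δ (1 + |Ybar| + |C₀| + 1 / (p : ℝ) + 1 / (1 - p)) := by
  have hq : 0 < 1 - (p : ℝ) := by linarith
  have hi : 0 < 1 / (p : ℝ) := by positivity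
  have hi' : 0 < 1 / (1 - (p : ℝ)) := by positivity
  have hY := abs_nonneg Ybar
  have hC := abs_nonneg C₀
  set B : ℝ := 1 + |Ybar| + |C₀| + 1 / (p : ℝ) + 1 / (1 - p) with hB
  have hCB : C₀ ≤ B := (le_abs_self C₀).trans (by linarith)
  refine
    { one_le := by linarith
      bounded := fun i z => (hb i z).trans ((le_abs_self Ybar).trans (by linarith))
      nonneg := hs.nonneg
      col_sum := fun j => (hs.col_sum j).trans hCB
      row_sum := fun i => (hs.row_sum i).trans hCB
      first := fun i k z =>
        (hs.first i k z).trans (mul_le_mul_of_nonneg_right hCB (hs.nonneg i k))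
      second := fun i k l hkl z => (hs.second i k l hkl z).trans
        (mul_le_mul_of_nonneg_right (mul_le_mul_of_nonneg_right hCB (hs.nonneg i k))
          (hs.nonneg i l))
      missing := fun i => ?_
      ipw_le := fun z k => ?_
      ipw_diff := ?_ }
  -- The weights vanish outside of the true neighbourhood, so the factor from `A` can be dropped.
  · have : ∀ l, G.missing W i l = W i l * A.entry i l * (1 - G.entry i l) := by
      intro l
      by_cases hl : l ∈ A.nbrs i
      · have : A.entry i l = 1 := if_pos (A.mem_nbrs.1 hl)
        rw [this, mul_one, Network.missing]
      · simp [Network.missing, hs.support i l hl]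
    simp_rw [this]
    exact (hg i).trans (mul_le_mul_of_nonneg_left ((hs.row_sum i).trans hCB) hδ)
  · cases hz : z k
    · have : ipw p z k = -(1 / (1 - (p : ℝ))) := by simp [ipw, treat, hz]
      rw [this, abs_neg, abs_of_pos hi']
      linarith
    · have : ipw p z k = 1 / (p : ℝ) := by simp [ipw, treat, hz]
      rw [this, abs_of_pos hi]
      linarith
  · rw [abs_of_pos (by linarith)]
    linarith

end NetInterf

theorem theorem3 (p : unitInterval) (hp0 : 0 < (p : ℝ)) (hp1 : (p : ℝ) < 1) (Ybar C₀ : ℝ) :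
    ∃ C : ℝ, ∀ (A G : ∀ n : ℕ, NetInterf.Network n) (Y : ∀ n : ℕ, NetInterf.Outcomes n)
      (W : ∀ n : ℕ, Matrix (Fin n) (Fin n) ℝ) (δ : ℕ → ℝ),
      (∀ n i, (A n).mat i i = true) →
      (∀ n, NetInterf.Bounded (Y n) Ybar) →
      (∀ n, NetInterf.SmoothOutcomes (A n) (Y n) (W n) C₀) →
      (∀ n, δ n ∈ Set.Icc (0 : ℝ) 1) →
      (∀ n, NetInterf.Gap (A n) (G n) (W n) (δ n)) →
      NetInterf.NonDegenerate p G Y →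
      (∀ n, NetInterf.SmoothThird (Y n) (W n) C₀) →
      (fun n : ℕ => ((G n).maxDeg : ℝ) ^ 6) =o[atTop] (fun n : ℕ => (n : ℝ)) →
      (∀ n i, NetInterf.meanT p (G n) (Y n) i =
        ∑ k ∈ (G n).nbrs i, ∫ z, NetInterf.psi (Y n i) k z ∂(NetInterf.design n p)) ∧
      ∃ b : ℕ → ℝ, (∀ n, |b n| ≤ C * δ n) ∧
        ∀ ε : ℝ, 0 < ε →
          Tendsto (fun n : ℕ => NetInterf.design n p
            {z | ε ≤ |(n : ℝ) / ((G n).maxDeg : ℝ) ^ 2 *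
                (NetInterf.sigmaHatSq p (G n) (Y n) z - NetInterf.sigmaSq p (G n) (Y n)) -
              (b n + NetInterf.hetero p (G n) (Y n))|}) atTop (𝓝 0) := by
  set B : ℝ := 1 + |Ybar| + |C₀| + 1 / (p : ℝ) + 1 / (1 - p) with hB
  refine ⟨14 * B ^ 6, fun A G Y W δ _ hb hs hδ hg _ _ hd => ?_⟩
  have hR : ∀ n, NetInterf.Regular p (G n) (Y n) (W n) (δ n) B := fun n =>
    NetInterf.regular_of_smooth hp0 hp1 (hb n) (hs n) (hδ n).1 (hg n)
  refine ⟨fun n i => NetInterf.meanT_eq p hp0 hp1 (G n) (Y n) i,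
    fun n => NetInterf.bias p (G n) (Y n),
    fun n => (hR n).abs_bias_le hp0 hp1 (hδ n).1, fun ε hε => ?_⟩
  -- `d ^ 4 ≤ d ^ 6` holds for natural numbers, including `d = 0`.
  have hd4 : Tendsto (fun n : ℕ => ((G n).maxDeg : ℝ) ^ 4 / n) atTop (𝓝 0) := by
    refine squeeze_zero (fun n => by positivity) (fun n => ?_) hd.tendsto_div_nhds_zero
    refine div_le_div_of_nonneg_right ?_ (by positivity)
    rcases Nat.eq_zero_or_pos (G n).maxDeg with h0 | h0
    · simp [h0]
    · exact pow_le_pow_right₀ (by exact_mod_cast h0) (by norm_num)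
  have hlim := ENNReal.tendsto_ofReal (hd4.const_mul (400 * B ^ 12 / ε ^ 2))
  rw [mul_zero, ENNReal.ofReal_zero] at hlim
  exact tendsto_of_tendsto_of_tendsto_of_le_of_le tendsto_const_nhds hlim (fun _ => bot_le)
    fun n => (hR n).measure_error_le hε
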